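/- Let $m\ge 0$, let $\mathcal B=\{b_1,\dots,b_m\}$ be an alphabet ("books") and let $\vec n=(n_1,\dots,n_m)\in\mathbb N^m$, $\mathbb N=\{0,1,2,\dots\}$, $L=n_1+\cdots+n_m$. Let $\Omega_{\vec n}$ be the set of words of content $\vec n$, that is, words of length $L$ over $\mathcal B$ in which each $b_i$ occurs exactly $n_i$ times. For $1\le i\le m$ and $1\le j\le n_i$ let $\partial_{b_i,j}\colon\Omega_{\vec n}\to\Omega_{\vec n}$ be the map that removes the $j$-th copy of $b_i$ (counted from the left) from a word and puts it back immediately to the right of the $(j-1)$-st copy of $b_i$, or at the front of the word if $j=1$. Let $x_{b_i,j}$ ($1\le i\le m$, $1\le j\le n_i$) be real numbers, for instance the probabilities with which the maps $\partial_{b_i,j}$ are chosen (so that they are nonnegative with sum $1$). The transition matrix of the Toom–Tsetlin chain is the $\Omega_{\vec n}\times\Omega_{\vec n}$ matrix $$T_{\vec n}(\alpha,\beta)=\sum_{(i,j)\,:\ \partial_{b_i,j}(\beta)=\alpha}x_{b_i,j}.$$ A word of content $\vec k=(k_1,\dots,k_m)\in\mathbb N^m$ is a derangement if in no position it has the same letter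 as the word $b_1^{k_1}b_2^{k_2}\cdots b_m^{k_m}$, and $d_{\vec k}$ denotes the number of derangements among the words of content $\vec k$. For $I_j\subseteq[n_j]=\{1,\dots,n_j\}$ put $x_{b_j,I_j}=\sum_{s\in I_j}x_{b_j,s}$. Then the characteristic polynomial of $T_{\vec n}$ is $$\det(\lambda\mathbb 1-T_{\vec n})=\prod_{I_1\subseteq[n_1],\dots,I_m\subseteq[n_m]}\Bigl(\lambda-\sum_{j=1}^m x_{b_j,I_j}\Bigr)^{d_{(n_1-|I_1|,\dots,n_m-|I_m|)}}.$$ If moreover $x_{b,k}=x_b$ for all $b\in\mathcal B$ and all $k$, then $$\det(\lambda\mathbb 1-T_{\vec n})=\prod_{0\le k_i\le n_i\ (1\le i\le m)}\Bigl(\lambda-\sum_{i=1}^m k_i\,x_{b_i}\Bigr)^{d_{(n_1-k_1,\dots,n_m-k_m)}\prod_{i=1}^m\binom{n_i}{k_i}}.$$ -/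

import Mathlib

open Polynomial

namespace ToomTsetlin

variable {m : ℕ}

/-- Books (letters) are the elements of `Fin m`, a shelf is a list of books, and `n b` is the
number of copies of `b`. `Word n` is the set of words of content `n`. -/
abbrev Word (n : Fin m → ℕ) : Type :=
  {w : List (Fin m) // ∀ b, w.count b = n b}

/-- The weakly increasing word `(1, …, 1, 2, …, 2, …, m, …, m)` of content `n`. -/
def sortedWord (n : Fin m → ℕ) : List (Fin m) :=
  (List.finRange m).flatMap fun b => List.replicate (n b) b

theorem count_sortedWord (n : Fin m → ℕ) (b : Fin m) : (sortedWord n).count b = n b := by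
  have key : ∀ l : List (Fin m), l.Nodup →
      (l.flatMap fun a => List.replicate (n a) a).count b = if b ∈ l then n b else 0 := by
    intro l
    induction l with
    | nil => simp
    | cons a l ih =>
      intro h
      rw [List.nodup_cons] at h
      rw [List.flatMap_cons, List.count_append, ih h.2, List.count_replicate]
      by_cases hab : a = b
      · subst hab
        simp [h.1]
      · have hba : ¬ b = a := fun e => hab e.symm
        simp [hab, hba]
  simpa [sortedWord] using key (List.finRange m) (List.nodup_finRange m)

instance (n : Fin m → ℕ) : Fintype (Word n) :=
  Fintype.subtype (sortedWord n).permutations.toFinset (by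
    intro w
    simp [List.mem_permutations, List.perm_iff_count, count_sortedWord])

/-- Take the `(j+1)`-st copy of the book `b` (counted from the left) off the shelf. -/
def removeCopy (b : Fin m) : ℕ → List (Fin m) → List (Fin m)
  | _, [] => []
  | 0, a :: w => if a = b then w else a :: removeCopy b 0 w
  | j + 1, a :: w => a :: removeCopy b (if a = b then j else j + 1) w

/-- Put a copy of `b` on the shelf, at the front if `j = 0` and otherwise immediately to the right
of the `j`-th copy of `b` (at the right end if there is no such copy, which does not occur
below). -/
def insertCopy (b : Fin m) : ℕ → List (Fin m) → List (Fin m)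
  | 0, w => b :: w
  | _ + 1, [] => [b]
  | j + 1, a :: w => a :: insertCopy b (if a = b then j else j + 1) w

theorem count_insertCopy (b c : Fin m) (w : List (Fin m)) :
    ∀ j, (insertCopy b j w).count c = w.count c + if b = c then 1 else 0 := by
  induction w with
  | nil => intro j; cases j <;> simp [insertCopy, List.count_cons]
  | cons a w ih =>
    intro j
    cases j with
    | zero => simp [insertCopy, List.count_cons]
    | succ j => simp only [insertCopy, List.count_cons, ih]; omega

theorem count_removeCopy (b c : Fin m) (w : List (Fin m)) :
    ∀ j, j < w.count b → (removeCopy b j w).count c + (if b = c then 1 else 0) = w.count c := by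
  induction w with
  | nil => intro j hj; simp at hj
  | cons a w ih =>
    intro j hj
    by_cases hab : a = b
    · subst hab
      cases j with
      | zero => simp [removeCopy, List.count_cons]
      | succ j =>
        have := ih j (by simpa using hj)
        simp only [removeCopy, if_true, List.count_cons]
        omega
    · have := ih j (by simpa [List.count_cons, hab] using hj)
      cases j with
      | zero => simp only [removeCopy, hab, if_false, List.count_cons]; omega
      | succ j => simp only [removeCopy, hab, if_false, List.count_cons]; omega

/-- The map `∂_{b,j+1}` on words of content `n`: the `(j+1)`-st copy of `b` is removed and put back
immediately to the right of the `j`-th copy of `b` (at the front of the word if `j = 0`). The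
copies of `b` are numbered from `1` on paper and by `Fin (n b)` here. -/
def move {n : Fin m → ℕ} (b : Fin m) (j : Fin (n b)) (w : Word n) : Word n :=
  ⟨insertCopy b j (removeCopy b j w.1), fun c => by
    rw [count_insertCopy, count_removeCopy b c w.1 j (by rw [w.2 b]; exact j.2), w.2 c]⟩

/-- The (column) transition matrix: its entry at `(α, β)` is the total weight of the moves that
take the state `β` to the state `α`, where `∂_{b,j}` is chosen with weight `x b j`. -/
def transitionMatrix (n : Fin m → ℕ) (x : ∀ b, Fin (n b) → ℝ) : Matrix (Word n) (Word n) ℝ :=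
  Matrix.of fun α β => ∑ b, ∑ j : Fin (n b), if move b j β = α then x b j else 0

/-- A word is a derangement if in no position it has the same letter as `sortedWord n`. -/
def IsDerangement {n : Fin m → ℕ} (w : Word n) : Prop :=
  ∀ (k : ℕ) (b : Fin m), w.1[k]? = some b → (sortedWord n)[k]? ≠ some b

/-- The number of derangements among the words of content `n`. -/
noncomputable def numDerangements (n : Fin m → ℕ) : ℕ :=
  Nat.card {w : Word n // IsDerangement w}

end ToomTsetlin

/-!
The characteristic polynomial of a real matrix is determined by the traces of its powers
(`charpoly_eq_of_trace_pow`), and for the `k`-th power of the transition matrix the trace is the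
sum, over all sequences of `k` moves, of the product of their weights times the number of fixed
points of their composite. So it suffices to count fixed points.

Let `S` be the set of copies moved by a composite `f`. Deleting these copies from a word gives a
word in the remaining copies, which `f` leaves alone. Conversely, two words `α`, `β` with the same
remainder become equal under a power of `f`. Suppose that they agree, as arrangements of labelled
copies, on a set `A` that contains the complement of `S`, and that every copy in `A ∩ S` comes with
its predecessor (the previous copy of the same book), if there is one. A move of a copy `s ∈ S`
keeps this agreement, and if the predecessor of `s` is in `A` (or `s` is a first copy), then
afterwards the words also agree on `A ∪ {s}`, because `s` now stands right after its predecessor.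
Each application of `f` thus enlarges `A` until it is everything (`exists_agree_moves`,
`exists_iterate_moves_eq`). Hence in every fibre of the deletion map some power of `f` is constant,
and `f` has exactly one fixed point there: the fixed points of `f` are equinumerous with the words
in the copies outside `S` (`card_fixedPoints_moves`).

Sorting the words in a set `T` of copies by the positions in which they differ from the sorted word
shows that their number is the sum over all `U ⊆ T` of the number of derangements in the content of
`U` (`card_word_eq_sum_numDerangements`). For `T = Sᶜ`, the condition `U ⊆ T` says that all moves
are taken from `Uᶜ`, so the trace of the `k`-th power of the transition matrix is the sum over `U`
of this number times the `k`-th power of the total weight of `Uᶜ`, as for a matrix with these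
eigenvalues.
-/

namespace ToomTsetlin

/-! ### Characteristic polynomials from traces of powers -/

/-- Multisets with equal power sums are equal. Since the sums of all polynomials over them agree,
this follows by testing on polynomials that vanish at all elements but one. -/
theorem multiset_eq_of_sum_map_pow_eq {K : Type*} [Field K] [CharZero K] {s t : Multiset K}
    (h : ∀ k : ℕ, (s.map (· ^ k)).sum = (t.map (· ^ k)).sum) : s = t := by
  classical
  have hp : ∀ p : K[X], (s.map p.eval).sum = (t.map p.eval).sum := by
    intro p
    induction p using Polynomial.induction_on' with
    | add p q hp hq => simp only [eval_add, Multiset.sum_map_add, hp, hq]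
    | monomial k a => simp only [eval_monomial, Multiset.sum_map_mul_left, h]
  ext z
  -- `q` vanishes at every element of `s + t` except `z`, so its sum over `s` is `q z` times the
  -- multiplicity of `z` in `s`
  set q : K[X] := ∏ y ∈ (s + t).toFinset.erase z, (X - C y) with hq
  have key : ∀ r : Multiset K, r ≤ s + t → (r.map q.eval).sum = r.count z * q.eval z := by
    intro r hr
    have : r.map q.eval = r.map fun y => if y = z then q.eval z else 0 := by
      refine Multiset.map_congr rfl fun y hy => ?_
      split_ifs with hyz
      · rw [hyz]
      · rw [hq, eval_prod]
        refine Finset.prod_eq_zero (i := y) ?_ (by simp)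
        simpa [hyz] using Multiset.mem_add.1 (Multiset.mem_of_le hr hy)
    rw [this]
    clear this hr
    induction r using Multiset.induction_on with
    | empty => simp
    | cons a r ih =>
      rcases eq_or_ne a z with rfl | haz
      · simp only [Multiset.map_cons, Multiset.sum_cons, ih, Multiset.count_cons_self, if_true]
        push_cast
        ring
      · simp [ih, haz, haz.symm]
  have hne : q.eval z ≠ 0 := by
    rw [hq, eval_prod, Finset.prod_ne_zero_iff]
    intro y hy
    simpa [sub_eq_zero] using (Finset.ne_of_mem_erase hy).symm
  have := hp q
  rw [key s (by simp), key t (by simp)] at this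
  exact_mod_cast mul_right_cancel₀ hne this

/-- The determinant of `q(M)` is the product of the values of `q` at the eigenvalues of `M`. -/
theorem det_aeval_eq_prod_roots_charpoly {K ι : Type*} [Field K] [IsAlgClosed K] [Fintype ι]
    [DecidableEq ι] (M : Matrix ι ι K) {q : K[X]} (hq : q.Monic) :
    (aeval M q).det = (M.charpoly.roots.map q.eval).prod := by
  have hlin : ∀ a : K, (aeval M (X - C a)).det = (M.charpoly.roots.map fun r => r - a).prod := by
    intro a
    have h1 : aeval M (X - C a) = -(Matrix.scalar ι a - M) := by
      simp [Matrix.algebraMap_eq_diagonal, Pi.algebraMap_def]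
    have hcard := (IsAlgClosed.splits M.charpoly).natDegree_eq_card_roots
    rw [Matrix.charpoly_natDegree_eq_dim] at hcard
    rw [h1, Matrix.det_neg, ← Matrix.eval_charpoly,
      (IsAlgClosed.splits M.charpoly).eval_eq_prod_roots_of_monic M.charpoly_monic, hcard,
      ← Multiset.prod_replicate, ← Multiset.map_const', ← Multiset.prod_map_mul]
    simp
  have hs := (IsAlgClosed.splits q).eq_prod_roots_of_monic hq
  have hgen : ∀ t : Multiset K, (aeval M (t.map (X - C ·)).prod).det =
      (M.charpoly.roots.map ((t.map (X - C ·)).prod).eval).prod := by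
    intro t
    induction t using Multiset.induction_on with
    | empty => simp
    | cons a t ih =>
      simp only [Multiset.map_cons, Multiset.prod_cons, map_mul, Matrix.det_mul, eval_mul,
        Multiset.prod_map_mul, ih, hlin, eval_sub, eval_X, eval_C]
  rw [hs]
  exact hgen _

/-- For `k ≠ 0` the eigenvalues of `M ^ k` are the `k`-th powers of those of `M`: evaluate
`det (X ^ k - a)(M)` for every scalar `a`. -/
theorem trace_pow_eq_sum_roots_charpoly {K ι : Type*} [Field K] [IsAlgClosed K] [Fintype ι]
    [DecidableEq ι] (M : Matrix ι ι K) {k : ℕ} (hk : k ≠ 0) :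
    (M ^ k).trace = (M.charpoly.roots.map (· ^ k)).sum := by
  have hcp : (M ^ k).charpoly = ((M.charpoly.roots.map (· ^ k)).map (X - C ·)).prod := by
    refine Polynomial.funext fun a => ?_
    have h1 : Matrix.scalar ι a - M ^ k = -aeval M (X ^ k - C a) := by
      simp [Matrix.algebraMap_eq_diagonal, Pi.algebraMap_def]
    have hcard := (IsAlgClosed.splits M.charpoly).natDegree_eq_card_roots
    rw [Matrix.charpoly_natDegree_eq_dim] at hcard
    rw [Matrix.eval_charpoly, h1, Matrix.det_neg,
      det_aeval_eq_prod_roots_charpoly M (monic_X_pow_sub_C a hk), hcard,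
      ← Multiset.prod_replicate, ← Multiset.map_const', ← Multiset.prod_map_mul,
      eval_multiset_prod, Multiset.map_map, Multiset.map_map]
    simp
  rw [Matrix.trace_eq_sum_roots_charpoly, hcp, roots_multiset_prod_X_sub_C]

/-- If the traces of the powers of a real matrix are the power sums of a real multiset (for `k = 0`,
the multiset has as many elements as the matrix has rows), then that multiset consists of its
eigenvalues. The proof passes to `ℂ`, where the characteristic polynomial splits. -/
theorem charpoly_eq_of_trace_pow {ι : Type*} [Fintype ι] [DecidableEq ι] (M : Matrix ι ι ℝ)
    (s : Multiset ℝ) (h : ∀ k : ℕ, (M ^ k).trace = (s.map (· ^ k)).sum) :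
    M.charpoly = (s.map (X - C ·)).prod := by
  refine Polynomial.map_injective _ Complex.ofRealHom.injective ?_
  rw [← Matrix.charpoly_map, Polynomial.map_multiset_prod, Multiset.map_map]
  set N := M.map Complex.ofRealHom with hN
  have hroots : N.charpoly.roots = s.map Complex.ofRealHom := by
    refine multiset_eq_of_sum_map_pow_eq fun k => ?_
    have hk := congrArg Complex.ofRealHom (h k)
    rw [map_multiset_sum, Multiset.map_map] at hk
    rw [Multiset.map_map]
    rcases eq_or_ne k 0 with rfl | hk0
    · have hcard := (IsAlgClosed.splits N.charpoly).natDegree_eq_card_roots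
      rw [Matrix.charpoly_natDegree_eq_dim] at hcard
      simpa [← hcard] using hk
    · rw [← trace_pow_eq_sum_roots_charpoly N hk0, hN, ← Matrix.map_pow]
      rw [AddMonoidHom.map_trace Complex.ofRealHom] at hk
      rw [hk]
      simp
  rw [(IsAlgClosed.splits N.charpoly).eq_prod_roots_of_monic N.charpoly_monic, hroots,
    Multiset.map_map]
  simp

/-! ### Labelled letters -/

/-- The list of labelled letters of a word: the letter `b` becomes `(b, c b + i)` at its
`(i+1)`-st occurrence. The offset `c` makes the recursion possible; it is `0` for a whole word. -/
def labels : (Fin m → ℕ) → List (Fin m) → List (Fin m × ℕ)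
  | _, [] => []
  | c, a :: w => (a, c a) :: labels (Function.update c a (c a + 1)) w

theorem map_fst_labels (w : List (Fin m)) : ∀ c, (labels c w).map Prod.fst = w := by
  induction w with
  | nil => intro c; rfl
  | cons a w ih => intro c; simp [labels, ih]

theorem mem_labels (w : List (Fin m)) : ∀ (c : Fin m → ℕ) (s : Fin m × ℕ),
    s ∈ labels c w ↔ c s.1 ≤ s.2 ∧ s.2 < c s.1 + w.count s.1 := by
  induction w with
  | nil => intro c s; simp [labels]
  | cons a w ih =>
    rintro c ⟨b, j⟩
    rw [labels, List.mem_cons, ih]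
    rcases eq_or_ne b a with rfl | hba
    · simp only [Prod.mk.injEq, true_and, Function.update_self, List.count_cons_self]
      omega
    · simp [hba, hba.symm]

theorem pairwise_labels (w : List (Fin m)) : ∀ c : Fin m → ℕ,
    (labels c w).Pairwise fun s t => s.1 = t.1 → s.2 < t.2 := by
  induction w with
  | nil => intro c; exact List.Pairwise.nil
  | cons a w ih =>
    intro c
    refine List.Pairwise.cons ?_ (ih _)
    rintro ⟨b, j⟩ hs h
    obtain rfl : a = b := h
    have := ((mem_labels w _ _).1 hs).1
    simp at this
    exact this

/-- The effect of a move on labelled letters: `s = (b, j)` is taken out and put back immediately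
after `(b, j - 1)`, or at the front if `j` is the first label `i`. -/
def moveLabel (i : ℕ) (s : Fin m × ℕ) (l : List (Fin m × ℕ)) : List (Fin m × ℕ) :=
  if s.2 = i then s :: l.filter (· ≠ s)
  else (l.filter (· ≠ s)).flatMap fun t => if t = (s.1, s.2 - 1) then [t, s] else [t]

theorem labels_removeCopy_zero (b : Fin m) (w : List (Fin m)) : ∀ c : Fin m → ℕ,
    labels (Function.update c b (c b + 1)) (removeCopy b 0 w) =
      (labels c w).filter (· ≠ (b, c b)) := by
  induction w with
  | nil => intro c; rfl
  | cons a w ih =>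
    intro c
    rcases eq_or_ne a b with rfl | hab
    · rw [removeCopy, if_pos rfl, labels, List.filter_cons_of_neg (by simp), eq_comm,
        List.filter_eq_self]
      rintro ⟨d, j⟩ hs
      have := ((mem_labels w _ _).1 hs).1
      simp only [decide_eq_true_eq, ne_eq, Prod.mk.injEq, not_and]
      rintro rfl rfl
      simp at this
    · rw [removeCopy, if_neg hab, labels, labels, List.filter_cons_of_pos (by simp [hab]),
        Function.update_of_ne hab, Function.update_comm hab.symm]
      have := ih (Function.update c a (c a + 1))
      rw [Function.update_of_ne hab.symm] at this
      rw [this]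

/-- In terms of labelled letters, a move is the operation `moveLabel`; in particular it does not
change the labels of the other copies. -/
theorem labels_move (b : Fin m) (w : List (Fin m)) : ∀ (c : Fin m → ℕ) (j : ℕ), j < w.count b →
    labels c (insertCopy b j (removeCopy b j w)) = moveLabel (c b) (b, c b + j) (labels c w) := by
  have hzero : ∀ (w : List (Fin m)) (c : Fin m → ℕ),
      labels c (insertCopy b 0 (removeCopy b 0 w)) =
        (b, c b) :: (labels c w).filter (· ≠ (b, c b)) := by
    intro w c
    rw [insertCopy, labels, labels_removeCopy_zero]
  induction w with
  | nil => intro c j hj; simp at hj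
  | cons a w ih =>
    intro c j hj
    cases j with
    | zero => rw [hzero, moveLabel, if_pos (by simp), add_zero]
    | succ j =>
      rcases eq_or_ne a b with rfl | hab
      · have hj' : j < w.count a := by simpa using hj
        rw [removeCopy, if_pos rfl, insertCopy, if_pos rfl, labels, labels, moveLabel,
          if_neg (by simp), List.filter_cons_of_pos (by simp), List.flatMap_cons]
        cases j with
        | zero =>
          rw [hzero, if_pos (by simp)]
          simp only [Function.update_self, zero_add, List.cons_append, List.nil_append,
            List.cons.injEq, true_and]
          rw [List.flatMap_congr (g := fun t => [t]), List.flatMap_singleton']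
          rintro ⟨d, i⟩ hs
          have := ((mem_labels w _ _).1 (List.mem_of_mem_filter hs)).1
          rw [if_neg]
          rintro ⟨⟩
          simp at this
        | succ j =>
          rw [ih _ _ hj', moveLabel, if_neg (by simp), if_neg (by simp)]
          simp only [Function.update_self, List.cons_append, List.nil_append]
          have e : c a + 1 + (j + 1) = c a + (j + 1 + 1) := by omega
          rw [e]
      · have hj' : j + 1 < w.count b := by simpa [hab] using hj
        rw [removeCopy, if_neg hab, insertCopy, if_neg hab, labels, labels, moveLabel,
          if_neg (by simp), List.filter_cons_of_pos (by simp [hab]), List.flatMap_cons,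
          if_neg (by simp [hab]), ih _ _ hj', Function.update_of_ne hab.symm, moveLabel,
          if_neg (by simp)]
        rfl

/-- Two lists of labelled letters in which the labels of each letter increase agree as soon as they
contain the same labelled letters and agree after erasing the labels. -/
theorem eq_of_map_fst_eq : ∀ l₁ l₂ : List (Fin m × ℕ),
    l₁.Pairwise (fun s t => s.1 = t.1 → s.2 < t.2) →
    l₂.Pairwise (fun s t => s.1 = t.1 → s.2 < t.2) →
    (∀ s, s ∈ l₁ ↔ s ∈ l₂) → l₁.map Prod.fst = l₂.map Prod.fst → l₁ = l₂ := by
  intro l₁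
  induction l₁ with
  | nil => intro l₂ _ _ _ h; simpa using h.symm
  | cons s l₁ ih =>
    intro l₂ h₁ h₂ hmem h
    cases l₂ with
    | nil => simp at h
    | cons t l₂ =>
      rw [List.map_cons, List.map_cons, List.cons.injEq] at h
      rw [List.pairwise_cons] at h₁ h₂
      have hst : s = t := by
        by_contra hne
        have a := h₁.1 t (by simpa [Ne.symm hne] using (hmem t).2 (by simp)) h.1
        have b := h₂.1 s (by simpa [hne] using (hmem s).1 (by simp)) h.1.symm
        omega
      subst hst
      rw [ih l₂ h₁.2 h₂.2 ?_ h.2]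
      intro u
      have := hmem u
      simp only [List.mem_cons] at this
      have n₁ : s ∉ l₁ := fun hs => absurd (h₁.1 s hs rfl) (lt_irrefl _)
      have n₂ : s ∉ l₂ := fun hs => absurd (h₂.1 s hs rfl) (lt_irrefl _)
      rcases eq_or_ne u s with rfl | hus
      · simp [n₁, n₂]
      · simpa [hus] using this

/-! ### Deleting labelled letters -/

theorem count_map_fst_filter_labels (A : Finset (Fin m × ℕ)) (b : Fin m) (w : List (Fin m)) :
    ∀ c : Fin m → ℕ, (((labels c w).filter (· ∈ A)).map Prod.fst).count b =
      ∑ j ∈ Finset.Ico (c b) (c b + w.count b), if (b, j) ∈ A then 1 else 0 := by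
  induction w with
  | nil => intro c; simp [labels]
  | cons a w ih =>
    intro c
    have h := ih (Function.update c a (c a + 1))
    rw [labels]
    rcases eq_or_ne a b with rfl | hab
    · rw [List.count_cons_self, Finset.sum_eq_sum_Ico_succ_bot (by omega)]
      rw [Function.update_self, show c a + 1 + w.count a = c a + (w.count a + 1) by omega] at h
      rw [← h]
      by_cases hA : (a, c a) ∈ A
      · rw [List.filter_cons_of_pos (by simpa using hA)]
        simp [hA, add_comm]
      · rw [List.filter_cons_of_neg (by simpa using hA)]
        simp [hA]
    · rw [List.count_cons_of_ne hab, ← Function.update_of_ne hab.symm (c a + 1) c, ← h]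
      by_cases hA : (a, c a) ∈ A
      · rw [List.filter_cons_of_pos (by simpa using hA), List.map_cons,
          List.count_cons_of_ne hab]
      · rw [List.filter_cons_of_neg (by simpa using hA)]

/-- Every word whose letters are as numerous as the labels in `A` arises by deleting from a word of
larger content all labelled letters outside `A`. -/
theorem exists_map_fst_filter_labels_eq (A : Finset (Fin m × ℕ)) (n : Fin m → ℕ) (N : ℕ) :
    ∀ (c : Fin m → ℕ) (u : List (Fin m)), (∀ b, c b ≤ n b) → ∑ b, (n b - c b) = N →
      (∀ b, u.count b = ∑ j ∈ Finset.Ico (c b) (n b), if (b, j) ∈ A then 1 else 0) →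
      ∃ w : List (Fin m), (∀ b, c b + w.count b = n b) ∧
        ((labels c w).filter (· ∈ A)).map Prod.fst = u := by
  induction N with
  | zero =>
    intro c u hc hN hu
    have hcn : ∀ b, c b = n b := fun b => by
      have := (Finset.sum_eq_zero_iff.1 hN) b (Finset.mem_univ b)
      have := hc b
      omega
    refine ⟨[], fun b => by simp [hcn b], ?_⟩
    have : u = [] := List.eq_nil_iff_forall_not_mem.2 fun b hb => by
      have h1 := List.count_pos_iff.2 hb
      rw [hu b, hcn b] at h1
      simp at h1
    simp [this, labels]
  | succ N ih =>
    intro c u hc hN hu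
    -- the induction step once the first letter `a` of the longer word has been found
    have step : ∀ (a : Fin m) (u' : List (Fin m)), c a < n a →
        (if (a, c a) ∈ A then a :: u' else u') = u →
        ∃ w : List (Fin m), (∀ b, c b + w.count b = n b) ∧
          ((labels c w).filter (· ∈ A)).map Prod.fst = u := by
      intro a u' ha hu'
      have hc' : ∀ b, Function.update c a (c a + 1) b ≤ n b := by
        intro b
        rcases eq_or_ne b a with rfl | hab
        · rw [Function.update_self]; omega
        · rw [Function.update_of_ne hab]; exact hc b
      have hN' : ∑ b, (n b - Function.update c a (c a + 1) b) = N := by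
        have h1 := Finset.add_sum_erase Finset.univ (fun b => n b - c b) (Finset.mem_univ a)
        have h2 := Finset.add_sum_erase Finset.univ
          (fun b => n b - Function.update c a (c a + 1) b) (Finset.mem_univ a)
        have h3 : ∑ b ∈ Finset.univ.erase a, (n b - Function.update c a (c a + 1) b) =
            ∑ b ∈ Finset.univ.erase a, (n b - c b) :=
          Finset.sum_congr rfl fun b hb => by
            rw [Function.update_of_ne (Finset.ne_of_mem_erase hb)]
        simp only [Function.update_self] at h2
        omega
      have hcu' : ∀ b, u'.count b =
          ∑ j ∈ Finset.Ico (Function.update c a (c a + 1) b) (n b),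
            if (b, j) ∈ A then 1 else 0 := by
        intro b
        have hub := hu b
        rcases eq_or_ne a b with rfl | hab
        · rw [Finset.sum_eq_sum_Ico_succ_bot ha] at hub
          rw [Function.update_self]
          rw [← hu'] at hub
          split_ifs at hub with hA
          · rw [List.count_cons_self] at hub
            omega
          · omega
        · rw [Function.update_of_ne hab.symm, ← hub, ← hu']
          split_ifs with hA
          · rw [List.count_cons_of_ne hab]
          · rfl
      obtain ⟨w, hw, hw'⟩ := ih (Function.update c a (c a + 1)) u' hc' hN' hcu'
      refine ⟨a :: w, fun b => ?_, ?_⟩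
      · have := hw b
        rcases eq_or_ne a b with rfl | hab
        · rw [Function.update_self] at this
          rw [List.count_cons_self]
          omega
        · rw [Function.update_of_ne hab.symm] at this
          rw [List.count_cons_of_ne hab, this]
      · rw [labels, ← hu', ← hw']
        by_cases hA : (a, c a) ∈ A
        · rw [List.filter_cons_of_pos (by simpa using hA), if_pos hA, List.map_cons]
        · rw [List.filter_cons_of_neg (by simpa using hA), if_neg hA]
    by_cases hex : ∃ a, c a < n a ∧ (a, c a) ∉ A
    · obtain ⟨a, ha, haA⟩ := hex
      exact step a u ha (if_neg haA)
    · push Not at hex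
      -- now every available next copy is in `A`, so the first letter of `u` has to come next
      cases u with
      | nil =>
        exfalso
        obtain ⟨b, -, hb⟩ := Finset.exists_ne_zero_of_sum_ne_zero (hN.trans_ne N.succ_ne_zero)
        have hub := hu b
        rw [Finset.sum_eq_sum_Ico_succ_bot (by omega), if_pos (hex b (by omega))] at hub
        simp at hub
        omega
      | cons a u =>
        have ha : c a < n a := by
          by_contra hle
          have hua := hu a
          rw [Finset.Ico_eq_empty (by omega)] at hua
          simp at hua
        exact step a u ha (if_pos (hex a ha))

theorem filter_moveLabel_of_notMem {A : Finset (Fin m × ℕ)} {s : Fin m × ℕ} (hs : s ∉ A) (i : ℕ)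
    (l : List (Fin m × ℕ)) : (moveLabel i s l).filter (· ∈ A) = l.filter (· ∈ A) := by
  have h : (l.filter (· ≠ s)).filter (· ∈ A) = l.filter (· ∈ A) := by
    rw [List.filter_filter]
    refine List.filter_congr fun t _ => ?_
    by_cases ht : t = s
    · simp [ht, hs]
    · simp [ht]
  rw [moveLabel]
  split_ifs
  · rw [List.filter_cons_of_neg (by simpa using hs), h]
  · rw [List.filter_flatMap, ← h]
    generalize l.filter (· ≠ s) = l'
    induction l' with
    | nil => rfl
    | cons t l' ih =>
      rw [List.flatMap_cons, ih]
      split_ifs with ht <;> by_cases htA : t ∈ A <;> simp [hs, htA]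

/-- If `A` contains the predecessor of `s`, then moving `s` commutes with restriction to `A`, after
which `s` is present whether or not it was in `A`. -/
theorem filter_moveLabel_of_pred {A : Finset (Fin m × ℕ)} {s : Fin m × ℕ} {i : ℕ}
    (hs : s.2 = i ∨ (s.1, s.2 - 1) ∈ A) (l : List (Fin m × ℕ)) :
    (moveLabel i s l).filter (· ∈ insert s A) = moveLabel i s (l.filter (· ∈ A)) := by
  have h : (l.filter (· ≠ s)).filter (· ∈ insert s A) =
      (l.filter (· ∈ A)).filter (· ≠ s) := by
    rw [List.filter_filter, List.filter_filter]
    refine List.filter_congr fun t _ => ?_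
    by_cases ht : t = s <;> simp [ht]
  rw [moveLabel, moveLabel]
  split_ifs with hi
  · rw [List.filter_cons_of_pos (by simp), h]
  · have hA := hs.resolve_left hi
    rw [← h, List.filter_flatMap]
    generalize l.filter (· ≠ s) = l'
    induction l' with
    | nil => rfl
    | cons t l' ih =>
      rw [List.flatMap_cons, ih]
      by_cases htA : t ∈ insert s A
      · rw [List.filter_cons_of_pos (by simpa using htA), List.flatMap_cons]
        congr 1
        split_ifs with ht
        · rw [List.filter_eq_self]
          simp [ht, hA]
        · simpa using htA
      · rw [List.filter_cons_of_neg (by simpa using htA)]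
        have ht : t ≠ (s.1, s.2 - 1) := fun h => htA (by rw [h]; simp [hA])
        rw [if_neg ht]
        simpa using htA

/-! ### Fixed points of composites of moves -/

/-- The labelled letter of a copy of a book. -/
def copyLabel (n : Fin m → ℕ) : ((b : Fin m) × Fin (n b)) ↪ Fin m × ℕ where
  toFun s := (s.1, s.2)
  inj' := by
    rintro ⟨b, j⟩ ⟨c, k⟩ h
    simp only [Prod.mk.injEq] at h
    obtain ⟨rfl, h⟩ := h
    rw [Fin.ext h]

/-- The composite of the moves of the copies in a list, the last one being made first. -/
def moves {n : Fin m → ℕ} (v : List ((b : Fin m) × Fin (n b))) (α : Word n) : Word n :=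
  v.foldr (fun s β => move s.1 s.2 β) α

theorem labels_move_word {n : Fin m → ℕ} (s : (b : Fin m) × Fin (n b)) (α : Word n) :
    labels 0 (move s.1 s.2 α).1 = moveLabel 0 (copyLabel n s) (labels 0 α.1) := by
  have := labels_move s.1 α.1 0 s.2 (by rw [α.2]; exact s.2.2)
  rw [Pi.zero_apply, zero_add] at this
  exact this

/-- The arrangement of the copies that are not moved stays the same. -/
theorem filter_labels_moves {n : Fin m → ℕ} {A : Finset (Fin m × ℕ)}
    (v : List ((b : Fin m) × Fin (n b))) (hv : ∀ s ∈ v, copyLabel n s ∉ A) (α : Word n) :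
    (labels 0 (moves v α).1).filter (· ∈ A) = (labels 0 α.1).filter (· ∈ A) := by
  induction v with
  | nil => rfl
  | cons s v ih =>
    rw [← ih fun t ht => hv t (List.mem_cons_of_mem s ht)]
    change (labels 0 (move s.1 s.2 (moves v α)).1).filter _ = _
    rw [labels_move_word, filter_moveLabel_of_notMem (hv s List.mem_cons_self)]

/-- If two words agree on a set `A` of copies in which every movable copy comes with its
predecessor, then after the moves in `v` they agree on a larger such set, which contains every copy
in `v` whose predecessor is in `A`: that copy has been put next to its predecessor. -/
theorem exists_agree_moves {n : Fin m → ℕ} {S A : Finset (Fin m × ℕ)} {α β : Word n}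
    (hA : ∀ s ∈ A, s ∈ S → s.2 = 0 ∨ (s.1, s.2 - 1) ∈ A)
    (h : (labels 0 α.1).filter (· ∈ A) = (labels 0 β.1).filter (· ∈ A))
    (v : List ((b : Fin m) × Fin (n b))) (hv : ∀ s ∈ v, copyLabel n s ∈ S) :
    ∃ B : Finset (Fin m × ℕ), A ⊆ B ∧ (∀ s ∈ B, s ∈ S → s.2 = 0 ∨ (s.1, s.2 - 1) ∈ B) ∧
      (labels 0 (moves v α).1).filter (· ∈ B) = (labels 0 (moves v β).1).filter (· ∈ B) ∧
      ∀ s ∈ v, (copyLabel n s).2 = 0 ∨ ((copyLabel n s).1, (copyLabel n s).2 - 1) ∈ A →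
        copyLabel n s ∈ B := by
  induction v with
  | nil => exact ⟨A, subset_rfl, hA, h, by simp⟩
  | cons s v ih =>
    obtain ⟨B, hAB, hB, hag, hvB⟩ := ih fun t ht => hv t (List.mem_cons_of_mem s ht)
    have e : ∀ γ : Word n, moves (s :: v) γ = move s.1 s.2 (moves v γ) := fun _ => rfl
    by_cases hs : (copyLabel n s).2 = 0 ∨ ((copyLabel n s).1, (copyLabel n s).2 - 1) ∈ B
    · refine ⟨insert (copyLabel n s) B, hAB.trans (Finset.subset_insert _ _), ?_, ?_, ?_⟩
      · intro t ht htS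
        rcases Finset.mem_insert.1 ht with rfl | ht
        · exact hs.imp_right fun h => Finset.mem_insert_of_mem h
        · exact (hB t ht htS).imp_right fun h => Finset.mem_insert_of_mem h
      · rw [e, e, labels_move_word, labels_move_word, filter_moveLabel_of_pred hs,
          filter_moveLabel_of_pred hs, hag]
      · intro t ht htA
        rcases List.mem_cons.1 ht with rfl | ht
        · exact Finset.mem_insert_self _ _
        · exact Finset.mem_insert_of_mem (hvB t ht htA)
    · have hsB : copyLabel n s ∉ B := fun h => hs (hB _ h (hv s List.mem_cons_self))
      refine ⟨B, hAB, hB, ?_, ?_⟩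
      · rw [e, e, labels_move_word, labels_move_word, filter_moveLabel_of_notMem hsB,
          filter_moveLabel_of_notMem hsB, hag]
      · intro t ht htA
        rcases List.mem_cons.1 ht with rfl | ht
        · exact absurd (htA.imp_right fun h => hAB h) hs
        · exact hvB t ht htA

theorem copyLabel_mem_labels {n : Fin m → ℕ} (α : Word n) (s : Fin m × ℕ) :
    s ∈ labels 0 α.1 ↔ s ∈ Finset.univ.map (copyLabel n) := by
  rw [mem_labels, α.2]
  simp only [Pi.zero_apply, zero_le, zero_add, true_and, Finset.mem_map, Finset.mem_univ]
  constructor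
  · intro h
    exact ⟨⟨s.1, ⟨s.2, h⟩⟩, rfl⟩
  · rintro ⟨t, rfl⟩
    exact t.2.2

/-- Repeating a composite of moves makes words equal that agree on the copies which are not moved:
each repetition enlarges the set of copies on which they agree. -/
theorem exists_iterate_moves_eq {n : Fin m → ℕ} (v : List ((b : Fin m) × Fin (n b))) (N : ℕ) :
    ∀ (A : Finset (Fin m × ℕ)) (α β : Word n),
      (∀ s ∈ A, s ∈ v.toFinset.map (copyLabel n) → s.2 = 0 ∨ (s.1, s.2 - 1) ∈ A) →
      (∀ s, s ∉ v → copyLabel n s ∈ A) →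
      (labels 0 α.1).filter (· ∈ A) = (labels 0 β.1).filter (· ∈ A) →
      (Finset.univ.map (copyLabel n) \ A).card = N →
      ∃ k, (moves v)^[k] α = (moves v)^[k] β := by
  induction N using Nat.strong_induction_on with
  | _ N ih =>
    intro A α β hA hvA h hN
    rcases (Finset.univ.map (copyLabel n) \ A).eq_empty_or_nonempty with he | hne
    · refine ⟨0, Subtype.ext ?_⟩
      have hall : ∀ γ : Word n, (labels 0 γ.1).filter (· ∈ A) = labels 0 γ.1 := by
        intro γ
        rw [List.filter_eq_self]
        intro s hs
        simpa using Finset.sdiff_eq_empty_iff_subset.1 he ((copyLabel_mem_labels γ s).1 hs)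
      rw [hall, hall] at h
      simpa [map_fst_labels] using congrArg (List.map Prod.fst) h
    -- copies outside `A` are all moved, and one of least label has its predecessor in `A`
    · obtain ⟨t, ht, hmin⟩ := Finset.exists_min_image _ Prod.snd hne
      obtain ⟨ht1, htA⟩ := Finset.mem_sdiff.1 ht
      obtain ⟨s, -, rfl⟩ := Finset.mem_map.1 ht1
      have hsv : s ∈ v := by
        by_contra hs
        exact htA (hvA s hs)
      have hpred : (copyLabel n s).2 = 0 ∨
          ((copyLabel n s).1, (copyLabel n s).2 - 1) ∈ A := by
        rw [or_iff_not_imp_left]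
        intro h0
        by_contra hp
        have hlt : (copyLabel n s).2 - 1 < n s.1 := by
          have : (copyLabel n s).2 < n s.1 := s.2.2
          omega
        have := hmin ((copyLabel n s).1, (copyLabel n s).2 - 1) (Finset.mem_sdiff.2
          ⟨Finset.mem_map.2 ⟨⟨s.1, ⟨_, hlt⟩⟩, Finset.mem_univ _, rfl⟩, hp⟩)
        simp only at this
        omega
      obtain ⟨B, hAB, hB, hag, hvB⟩ := exists_agree_moves hA h v fun s hs =>
        Finset.mem_map_of_mem _ (List.mem_toFinset.2 hs)
      obtain ⟨k, hk⟩ := ih _ (by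
        rw [← hN]
        refine Finset.card_lt_card (Finset.ssubset_iff_of_subset
          (Finset.sdiff_subset_sdiff subset_rfl hAB) |>.2 ⟨copyLabel n s, ht, ?_⟩)
        simp [hvB s hsv hpred]) B _ _ hB (fun s hs => hAB (hvA s hs)) hag rfl
      exact ⟨k + 1, by simpa only [Function.iterate_succ_apply] using hk⟩

theorem sum_Ico_ite_mem_map_copyLabel (n : Fin m → ℕ) (T : Finset ((b : Fin m) × Fin (n b)))
    (b : Fin m) :
    (∑ j ∈ Finset.Ico 0 (n b), if (b, j) ∈ T.map (copyLabel n) then 1 else 0) =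
      (T.filter fun s => s.1 = b).card := by
  rw [← Finset.card_filter]
  symm
  refine Finset.card_bij (fun s _ => s.2.1) ?_ ?_ ?_
  · rintro ⟨c, j⟩ hs
    obtain ⟨hT, hc⟩ := Finset.mem_filter.1 hs
    obtain rfl : c = b := hc
    exact Finset.mem_filter.2 ⟨by simp, Finset.mem_map_of_mem (copyLabel n) hT⟩
  · rintro ⟨c, j⟩ hs ⟨d, k⟩ ht h
    obtain ⟨-, rfl⟩ := Finset.mem_filter.1 hs
    obtain ⟨-, hd⟩ := Finset.mem_filter.1 ht
    obtain rfl : d = c := hd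
    exact congrArg (Sigma.mk d) (Fin.ext h)
  · intro j hj
    obtain ⟨-, hj⟩ := Finset.mem_filter.1 hj
    obtain ⟨s, hs, hsj⟩ := Finset.mem_map.1 hj
    exact ⟨s, Finset.mem_filter.2 ⟨hs, congrArg Prod.fst hsj⟩, congrArg Prod.snd hsj⟩

/-- The number of fixed points of a composite of moves only depends on the set of copies moved:
deleting these copies is a bijection from the fixed points to the words of the remaining
content. -/
theorem card_fixedPoints_moves {n : Fin m → ℕ} (v : List ((b : Fin m) × Fin (n b))) :
    Fintype.card {α : Word n // moves v α = α} =
      Fintype.card (Word fun b => ((v.toFinset)ᶜ.filter fun s => s.1 = b).card) := by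
  set A : Finset (Fin m × ℕ) := (v.toFinset)ᶜ.map (copyLabel n) with hAdef
  have hmemA : ∀ s, copyLabel n s ∈ A ↔ s ∉ v := by simp [hAdef]
  have hiter : ∀ α β : Word n,
      (labels 0 α.1).filter (· ∈ A) = (labels 0 β.1).filter (· ∈ A) →
      ∃ k, (moves v)^[k] α = (moves v)^[k] β := fun α β h =>
    exists_iterate_moves_eq v _ A α β (fun s hs hsv => by
      obtain ⟨t, ht, rfl⟩ := Finset.mem_map.1 hsv
      exact absurd (List.mem_toFinset.1 ht) ((hmemA t).1 hs)) (fun s hs => (hmemA s).2 hs) h rfl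
  have hinv : ∀ (α : Word n), (labels 0 (moves v α).1).filter (· ∈ A) =
      (labels 0 α.1).filter (· ∈ A) :=
    filter_labels_moves v fun s hs h => (hmemA s).1 h hs
  have hcount : ∀ (α : Word n) b, (((labels 0 α.1).filter (· ∈ A)).map Prod.fst).count b =
      ((v.toFinset)ᶜ.filter fun s => s.1 = b).card := by
    intro α b
    rw [count_map_fst_filter_labels, ← sum_Ico_ite_mem_map_copyLabel, α.2]
    simp only [Pi.zero_apply, zero_add, hAdef]
  refine Fintype.card_of_bijective (f := fun α : {α : Word n // moves v α = α} =>
    (⟨((labels 0 α.1.1).filter (· ∈ A)).map Prod.fst, hcount α.1⟩ : Word _)) ⟨?_, ?_⟩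
  · rintro ⟨α, hα⟩ ⟨β, hβ⟩ h
    have h' := eq_of_map_fst_eq _ _ ((pairwise_labels α.1 0).filter _)
      ((pairwise_labels β.1 0).filter _) (fun s => by
        rw [List.mem_filter, List.mem_filter, copyLabel_mem_labels, copyLabel_mem_labels])
      (congrArg Subtype.val h)
    obtain ⟨k, hk⟩ := hiter α β h'
    refine Subtype.ext ?_
    change α = β
    rwa [Function.iterate_fixed hα, Function.iterate_fixed hβ] at hk
  · intro u
    obtain ⟨w, hw, hwu⟩ := exists_map_fst_filter_labels_eq A n _ 0 u.1 (by simp) rfl (fun b => by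
      rw [u.2 b, hAdef, Pi.zero_apply, sum_Ico_ite_mem_map_copyLabel])
    set α : Word n := ⟨w, fun b => by simpa using hw b⟩ with hα
    obtain ⟨k, hk⟩ := hiter (moves v α) α (hinv α)
    -- `v` fixes the common value of the `k`-th iterates of `α` and of its image
    refine ⟨⟨(moves v)^[k] α, ?_⟩, Subtype.ext ?_⟩
    · rw [← Function.iterate_succ_apply' (moves v), Function.iterate_succ_apply, hk]
    · have : ∀ k, (labels 0 ((moves v)^[k] α).1).filter (· ∈ A) =
          (labels 0 α.1).filter (· ∈ A) := by
        intro k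
        induction k with
        | zero => rfl
        | succ k ih => rw [Function.iterate_succ_apply', hinv, ih]
      change ((labels 0 ((moves v)^[k] α).1).filter (· ∈ A)).map Prod.fst = u.1
      rw [this, ← hwu]

/-! ### Words and derangements -/

theorem card_filter_ofFn {α : Type*} [DecidableEq α] {N : ℕ} (g : Fin N → α) (a : α) :
    (List.ofFn g).count a = (Finset.univ.filter fun i => g i = a).card := by
  have := Fin.card_filter_univ_eq_vector_get_eq_count a (List.Vector.ofFn g)
  simpa [List.Vector.get_ofFn, List.Vector.toList_ofFn] using this.symm

/-- Words of content `n`, written in the positions of `sortedWord n` (which are the copies `s`, the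
letter of the sorted word being `s.1`), that agree with the sorted word outside `T`. -/
def fillings (n : Fin m → ℕ) (T : Finset ((b : Fin m) × Fin (n b))) :
    Finset (((b : Fin m) × Fin (n b)) → Fin m) :=
  Finset.univ.filter fun f => (∀ s, s ∉ T → f s = s.1) ∧
    ∀ b, (T.filter fun s => f s = b).card = (T.filter fun s => s.1 = b).card

/-- The positions in `T` can be numbered so that they carry the letters of the sorted word of the
corresponding content. Hence `fillings n T` amounts to the words of that content, and differing
from the sorted word everywhere on `T` amounts to being a derangement. -/
theorem exists_fillings_equiv (n : Fin m → ℕ) (T : Finset ((b : Fin m) × Fin (n b))) :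
    ∃ Φ : fillings n T ≃ Word fun b => (T.filter fun s => s.1 = b).card,
      ∀ f, IsDerangement (Φ f) ↔ ∀ s ∈ T, f.1 s ≠ s.1 := by
  set k : Fin m → ℕ := fun b => (T.filter fun s => s.1 = b).card with hk
  have hfib : ∀ b, Nonempty ({i // (sortedWord k).get i = b} ≃ {s : T // s.1.1 = b}) := by
    intro b
    rw [← Fintype.card_eq, Fintype.card_subtype, ← card_filter_ofFn, List.ofFn_get,
      count_sortedWord, Fintype.card_subtype, hk]
    refine Finset.card_bij (fun s hs => (⟨s, (Finset.mem_filter.1 hs).1⟩ : T)) ?_ ?_ ?_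
    · intro s hs
      simpa using (Finset.mem_filter.1 hs).2
    · intro s _ t _ h
      exact congrArg Subtype.val h
    · intro s hs
      exact ⟨s, Finset.mem_filter.2 ⟨s.2, (Finset.mem_filter.1 hs).2⟩, rfl⟩
  set e : Fin (sortedWord k).length ≃ T := Equiv.ofFiberEquiv fun b => (hfib b).some with he
  have hletter : ∀ i, (e i).1.1 = (sortedWord k).get i := fun i =>
    Equiv.ofFiberEquiv_map (fun b => (hfib b).some) i
  have hcount : ∀ (f : ((b : Fin m) × Fin (n b)) → Fin m) b,
      (List.ofFn fun i => f (e i)).count b = (T.filter fun s => f s = b).card := by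
    intro f b
    rw [card_filter_ofFn]
    refine Finset.card_bij (fun i _ => (e i).1) ?_ ?_ ?_
    · intro i hi
      exact Finset.mem_filter.2 ⟨(e i).2, (Finset.mem_filter.1 hi).2⟩
    · intro i _ j _ h
      exact e.injective (Subtype.ext h)
    · intro s hs
      obtain ⟨hT, hb⟩ := Finset.mem_filter.1 hs
      exact ⟨e.symm ⟨s, hT⟩, by simpa using hb, by simp⟩
  let F : fillings n T → Word k := fun f => ⟨List.ofFn fun i => f.1 (e i), fun b => by
    rw [hcount, hk, ((Finset.mem_filter.1 f.2).2).2 b]⟩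
  have hF : Function.Bijective F := by
    constructor
    · intro f g hfg
      have h := List.ofFn_injective (congrArg Subtype.val hfg)
      refine Subtype.ext (funext fun s => ?_)
      by_cases hs : s ∈ T
      · simpa using congrFun h (e.symm ⟨s, hs⟩)
      · rw [((Finset.mem_filter.1 f.2).2).1 s hs, ((Finset.mem_filter.1 g.2).2).1 s hs]
    · intro w
      have hlen : w.1.length = (sortedWord k).length :=
        (List.perm_iff_count.2 fun b => by rw [w.2, count_sortedWord]).length_eq
      let f : ((b : Fin m) × Fin (n b)) → Fin m := fun s =>
        if hs : s ∈ T then w.1.get (Fin.cast hlen.symm (e.symm ⟨s, hs⟩)) else s.1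
      have hw : (List.ofFn fun i => f (e i)) = w.1 := by
        refine List.ext_get (by simp [hlen]) fun i h1 h2 => ?_
        simp [f]
      refine ⟨⟨f, Finset.mem_filter.2 ⟨Finset.mem_univ _, ?_, ?_⟩⟩, Subtype.ext hw⟩
      · intro s hs
        simp [f, hs]
      · intro b
        rw [← hcount, hw, w.2]
  refine ⟨Equiv.ofBijective F hF, fun f => ?_⟩
  change (∀ (i : ℕ) (b : Fin m), (List.ofFn fun i => f.1 (e i))[i]? = some b →
    (sortedWord k)[i]? ≠ some b) ↔ _
  constructor
  · intro h s hs hfs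
    refine h (e.symm ⟨s, hs⟩) s.1 ?_ ?_
    · rw [List.getElem?_ofFn, dif_pos (e.symm ⟨s, hs⟩).2]
      simpa using hfs
    · have := hletter (e.symm ⟨s, hs⟩)
      rw [Equiv.apply_symm_apply] at this
      rw [List.getElem?_eq_some_iff]
      exact ⟨(e.symm ⟨s, hs⟩).2, this.symm⟩
  · intro h i b hi hb
    obtain ⟨hi', hb'⟩ := List.getElem?_eq_some_iff.1 hb
    rw [List.getElem?_ofFn, dif_pos hi', Option.some_inj] at hi
    refine h (e ⟨i, hi'⟩).1 (e ⟨i, hi'⟩).2 ?_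
    rw [hi, hletter]
    exact hb'.symm

/-- Sorting words by the set of positions in which they differ from the sorted word. -/
theorem card_word_eq_sum_numDerangements (n : Fin m → ℕ)
    (T : Finset ((b : Fin m) × Fin (n b))) :
    Fintype.card (Word fun b => (T.filter fun s => s.1 = b).card) =
      ∑ U ∈ T.powerset, numDerangements fun b => (U.filter fun s => s.1 = b).card := by
  obtain ⟨Φ, -⟩ := exists_fillings_equiv n T
  rw [← Fintype.card_congr Φ, Fintype.card_coe,
    Finset.card_eq_sum_card_fiberwise (f := fun f => Finset.univ.filter fun s => f s ≠ s.1)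
      (t := T.powerset)]
  · refine Finset.sum_congr rfl fun U hU => ?_
    rw [Finset.mem_powerset] at hU
    obtain ⟨Ψ, hΨ⟩ := exists_fillings_equiv n U
    rw [numDerangements, ← Nat.card_congr (Ψ.subtypeEquiv (p := fun f => ∀ s ∈ U, f.1 s ≠ s.1)
      fun f => (hΨ f).symm), Nat.card_congr (Equiv.subtypeSubtypeEquivSubtypeInter
        (· ∈ fillings n U) fun f => ∀ s ∈ U, f s ≠ s.1)]
    refine (Nat.subtype_card _ fun f => ?_).symm
    have hcount : (∀ s, s ∉ U → f s = s.1) → ∀ b,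
        ((T.filter fun s => f s = b).card = (T.filter fun s => s.1 = b).card ↔
          (U.filter fun s => f s = b).card = (U.filter fun s => s.1 = b).card) := by
      intro hf b
      have h : (T \ U).filter (fun s => f s = b) = (T \ U).filter fun s => s.1 = b :=
        Finset.filter_congr fun s hs => by rw [hf s (Finset.mem_sdiff.1 hs).2]
      simp only [Finset.card_filter] at h ⊢
      rw [← Finset.sum_sdiff hU, ← Finset.sum_sdiff (f := fun s => if s.1 = b then 1 else 0) hU,
        ← Finset.card_filter, ← Finset.card_filter (fun s => s.1 = b) (T \ U), h,
        Nat.add_left_cancel_iff]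
    simp only [fillings, Finset.mem_filter, Finset.mem_univ, true_and]
    constructor
    · rintro ⟨⟨-, hT⟩, rfl⟩
      have hf : ∀ s, s ∉ (Finset.univ.filter fun s => f s ≠ s.1) → f s = s.1 := by simp
      exact ⟨⟨hf, fun b => (hcount hf b).1 (hT b)⟩, by simp⟩
    · rintro ⟨⟨hf, hb⟩, hne⟩
      refine ⟨⟨fun s hs => hf s fun h => hs (hU h), fun b => (hcount hf b).2 (hb b)⟩, ?_⟩
      ext s
      simp only [Finset.mem_filter, Finset.mem_univ, true_and]
      exact ⟨fun h => by_contra fun hs => h (hf s hs), hne s⟩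
  · intro f hf
    simp only [Finset.coe_powerset, Set.mem_preimage, Set.mem_powerset_iff, Finset.coe_subset]
    intro s hs
    by_contra hsT
    exact (Finset.mem_filter.1 hs).2 (((Finset.mem_filter.1 hf).2).1 s hsT)

/-! ### Traces and the characteristic polynomial -/

/-- Expansion of a power of the transition matrix over sequences of moves. -/
theorem transitionMatrix_pow_apply (n : Fin m → ℕ) (x : ∀ b, Fin (n b) → ℝ) (k : ℕ) :
    ∀ α β : Word n, (transitionMatrix n x ^ k) α β =
      ∑ v : Fin k → (b : Fin m) × Fin (n b),
        if moves (List.ofFn v) β = α then ∏ i, x (v i).1 (v i).2 else 0 := by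
  induction k with
  | zero =>
    intro α β
    simp [moves, Matrix.one_apply, eq_comm]
  | succ k ih =>
    intro α β
    rw [pow_succ', Matrix.mul_apply,
      ← (Fin.consEquiv fun _ => (b : Fin m) × Fin (n b)).sum_comp, Fintype.sum_prod_type]
    have hT : ∀ γ, transitionMatrix n x α γ =
        ∑ s : (b : Fin m) × Fin (n b), if move s.1 s.2 γ = α then x s.1 s.2 else 0 := by
      intro γ
      rw [transitionMatrix, Matrix.of_apply, Fintype.sum_sigma]
    simp only [ih, hT, Finset.sum_mul_sum]
    rw [Finset.sum_comm]
    refine Finset.sum_congr rfl fun s _ => ?_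
    rw [Finset.sum_comm]
    refine Finset.sum_congr rfl fun v _ => ?_
    rw [Finset.sum_eq_single (moves (List.ofFn v) β)]
    · have h : moves (List.ofFn (Fin.consEquiv (fun _ => (b : Fin m) × Fin (n b)) (s, v))) β =
          move s.1 s.2 (moves (List.ofFn v) β) := by
        simp [Fin.consEquiv, List.ofFn_succ, moves]
      rw [h, if_pos rfl, ite_mul, zero_mul, Fin.prod_univ_succ]
      rfl
    · intro γ _ hγ
      rw [if_neg hγ.symm, mul_zero]
    · simp

theorem trace_transitionMatrix_pow (n : Fin m → ℕ) (x : ∀ b, Fin (n b) → ℝ) (k : ℕ) :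
    (transitionMatrix n x ^ k).trace = ∑ U : Finset ((b : Fin m) × Fin (n b)),
      (numDerangements fun b => (U.filter fun s => s.1 = b).card : ℝ) *
        (∑ s ∈ Uᶜ, x s.1 s.2) ^ k := by
  calc (transitionMatrix n x ^ k).trace
      = ∑ v : Fin k → (b : Fin m) × Fin (n b),
          (Fintype.card {α : Word n // moves (List.ofFn v) α = α} : ℝ) *
            ∏ i, x (v i).1 (v i).2 := by
        simp only [Matrix.trace, Matrix.diag_apply, transitionMatrix_pow_apply]
        rw [Finset.sum_comm]
        refine Finset.sum_congr rfl fun v _ => ?_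
        rw [← Finset.sum_filter, Finset.sum_const, nsmul_eq_mul, Fintype.card_subtype]
    _ = ∑ v : Fin k → (b : Fin m) × Fin (n b), ∑ U : Finset ((b : Fin m) × Fin (n b)),
          if v ∈ Fintype.piFinset fun _ => Uᶜ then
            (numDerangements fun b => (U.filter fun s => s.1 = b).card : ℝ) *
              ∏ i, x (v i).1 (v i).2 else 0 := by
        refine Finset.sum_congr rfl fun v _ => ?_
        rw [card_fixedPoints_moves, card_word_eq_sum_numDerangements, Nat.cast_sum,
          Finset.sum_mul, ← Finset.sum_filter]
        refine Finset.sum_congr ?_ fun _ _ => rfl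
        ext U
        simp only [Finset.mem_powerset, Finset.mem_filter, Finset.mem_univ, true_and,
          Fintype.mem_piFinset, Finset.mem_compl]
        constructor
        · intro h i hi
          have := h hi
          simp at this
        · intro h s hs
          simp only [Finset.mem_compl, List.mem_toFinset, List.mem_ofFn]
          rintro ⟨i, rfl⟩
          exact h i hs
    _ = _ := by
        rw [Finset.sum_comm]
        refine Finset.sum_congr rfl fun U _ => ?_
        rw [← Finset.sum_filter, Finset.sum_pow', Finset.mul_sum]
        refine Finset.sum_congr ?_ fun _ _ => rfl
        ext v
        simp

/-- Each set `U` of copies contributes the total weight of the copies outside `U` as an eigenvalue,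
as often as there are derangements in the content of `U`. -/
theorem charpoly_transitionMatrix (n : Fin m → ℕ) (x : ∀ b, Fin (n b) → ℝ) :
    (transitionMatrix n x).charpoly = ∏ U : Finset ((b : Fin m) × Fin (n b)),
      (X - C (∑ s ∈ Uᶜ, x s.1 s.2)) ^
        numDerangements fun b => (U.filter fun s => s.1 = b).card := by
  rw [charpoly_eq_of_trace_pow _ (∑ U : Finset ((b : Fin m) × Fin (n b)),
    Multiset.replicate (numDerangements fun b => (U.filter fun s => s.1 = b).card)
      (∑ s ∈ Uᶜ, x s.1 s.2))]
  · generalize (Finset.univ : Finset (Finset ((b : Fin m) × Fin (n b)))) = 𝒮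
    classical
    induction 𝒮 using Finset.induction_on with
    | empty => simp
    | insert U 𝒮 hU ih =>
      rw [Finset.sum_insert hU, Finset.prod_insert hU, Multiset.map_add, Multiset.prod_add, ih,
        Multiset.map_replicate, Multiset.prod_replicate]
  · intro k
    rw [trace_transitionMatrix_pow, ← Multiset.coe_mapAddMonoidHom, map_sum,
      ← Multiset.coe_sumAddMonoidHom, map_sum]
    simp

theorem charpoly_transitionMatrix_eq_prod (n : Fin m → ℕ) (x : ∀ b, Fin (n b) → ℝ) :
    (transitionMatrix n x).charpoly = ∏ I : ((b : Fin m) → Finset (Fin (n b))),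
      (X - C (∑ b, ∑ s ∈ I b, x b s)) ^ numDerangements fun b => n b - (I b).card := by
  rw [charpoly_transitionMatrix]
  symm
  -- a family `I` corresponds to the set `U` of copies that belong to no `I b`
  refine Fintype.prod_bijective (fun I => (Finset.univ.sigma I)ᶜ) ⟨?_, ?_⟩ _ _ fun I => ?_
  · intro I J h
    funext b
    ext j
    have := congrArg (⟨b, j⟩ ∈ ·) (compl_injective h)
    simpa using this
  · intro U
    refine ⟨fun b => Finset.univ.filter fun j => ⟨b, j⟩ ∉ U, ?_⟩
    ext ⟨b, j⟩
    simp
  · rw [compl_compl, Finset.sum_sigma]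
    congr 2
    funext b
    have : ((Finset.univ.sigma I)ᶜ.filter fun s => s.1 = b) =
        (I b)ᶜ.map (Function.Embedding.sigmaMk b) := by
      ext ⟨c, j⟩
      simp only [Finset.mem_filter, Finset.mem_compl, Finset.mem_sigma, Finset.mem_univ,
        true_and, Finset.mem_map, Function.Embedding.sigmaMk_apply, Sigma.mk.injEq]
      constructor
      · rintro ⟨h, rfl⟩
        exact ⟨j, h, rfl, HEq.rfl⟩
      · rintro ⟨i, hi, rfl, h⟩
        obtain rfl := eq_of_heq h
        exact ⟨hi, rfl⟩
    rw [this, Finset.card_map, Finset.card_compl, Fintype.card_fin]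

theorem card_pi_finset_card_eq (n k : Fin m → ℕ) :
    (Finset.univ.filter fun I : (b : Fin m) → Finset (Fin (n b)) =>
      (fun b => (I b).card) = k).card = ∏ b, (n b).choose (k b) := by
  have : (Finset.univ.filter fun I : (b : Fin m) → Finset (Fin (n b)) =>
      (fun b => (I b).card) = k) =
      Fintype.piFinset fun b => Finset.powersetCard (k b) Finset.univ := by
    ext I
    simp [Fintype.mem_piFinset, Finset.mem_powersetCard, funext_iff]
  rw [this, Fintype.card_piFinset]
  simp [Finset.card_powersetCard]

end ToomTsetlin

theorem mainTheorem1 (m : ℕ) (n : Fin m → ℕ) :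
    (∀ x : (b : Fin m) → Fin (n b) → ℝ,
      (ToomTsetlin.transitionMatrix n x).charpoly =
        ∏ I : ((b : Fin m) → Finset (Fin (n b))),
          (X - C (∑ b, ∑ s ∈ I b, x b s)) ^
            ToomTsetlin.numDerangements (fun b => n b - (I b).card)) ∧
    (∀ y : Fin m → ℝ,
      (ToomTsetlin.transitionMatrix n (fun b _ => y b)).charpoly =
        ∏ k ∈ Finset.Iic n,
          (X - C (∑ b, (k b : ℝ) * y b)) ^
            (ToomTsetlin.numDerangements (fun b => n b - k b) *
              ∏ b, (n b).choose (k b))) := by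
  refine ⟨ToomTsetlin.charpoly_transitionMatrix_eq_prod n, fun y => ?_⟩
  rw [ToomTsetlin.charpoly_transitionMatrix_eq_prod,
    ← Finset.prod_fiberwise_of_maps_to (t := Finset.Iic n) (g := fun I b => (I b).card)]
  · refine Finset.prod_congr rfl fun k _ => ?_
    rw [pow_mul, ← ToomTsetlin.card_pi_finset_card_eq, ← Finset.prod_const]
    refine Finset.prod_congr rfl fun I hI => ?_
    obtain rfl := (Finset.mem_filter.1 hI).2
    simp
  · intro I _
    exact Finset.mem_Iic.2 fun b => by simpa using Finset.card_le_univ (I b)
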